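/- Let $\mathcal H$ be a separable complex Hilbert space, let $\mathcal B(\mathcal H)$ be the bounded operators on it, $\mathcal B^1(\mathcal H)$ the trace class, and $\mathcal B^2(\mathcal H)$ the Hilbert space of Hilbert–Schmidt operators with inner product $\langle X,Y\rangle=\operatorname{tr}(X^*Y)$. A linear map $\Phi:\mathcal B^1(\mathcal H)\to\mathcal B^1(\mathcal H)$ is completely positive if for every $n\in\mathbb N$ the map $(A_{jk})_{j,k=1}^n\mapsto(\Phi(A_{jk}))_{j,k=1}^n$ sends every positive semi-definite operator on $\mathbb C^n\otimes\mathcal H$ with entries $A_{jk}\in\mathcal B^1(\mathcal H)$ to a positive semi-definite operator. For $B\in\mathcal B^1(\mathcal H)$ let $\mathsf{CP}_B(\mathcal H)$ be the set of all completely positive linear maps $\Phi:\mathcal B^1(\mathcal H)\to\mathcal B^1(\mathcal H)$ such that the trace-class operator $X\mapsto\Phi(B^*XB)$ on the Hilbert space $\mathcal B^2(\mathcal H)$ has trace $0$. Let $K\in\mathcal B(\mathcal H)$ and let $B\in\mathcal B^1(\mathcal H)$ with $\operatorname{tr}(B)\neq0$. If there are $\Phi_1,\Phi_2\in\mathsf{CP}_B(\mathcal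 H)$ such that $KA+AK^*=\Phi_1(A)-\Phi_2(A)$ for all $A\in\mathcal B^1(\mathcal H)$, then $K=i\lambda\mathbf 1$ for some $\lambda\in\mathbb R$. -/

import Mathlib

noncomputable section

namespace QDyn

set_option linter.unusedSectionVars false

open scoped InnerProductSpace

/-! ### Orthonormal bases and the trace -/

section Trace

variable (E : Type*) [NormedAddCommGroup E] [InnerProductSpace ℂ E] [CompleteSpace E]

/-- Index set of the orthonormal basis `onb E`. -/
def onbIndex : Set E := Classical.choose (exists_hilbertBasis ℂ E)

/-- Some orthonormal basis of the Hilbert space `E`. -/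
def onb : HilbertBasis (onbIndex E) ℂ E :=
  Classical.choose (Classical.choose_spec (exists_hilbertBasis ℂ E))

variable {E}

/-- The trace `∑ⱼ ⟨gⱼ, T gⱼ⟩` over an orthonormal basis of `E`. For trace-class `T` the family is
absolutely summable and the sum does not depend on the basis. -/
def trace (T : E →ₗ[ℂ] E) : ℂ := ∑' j, ⟪onb E j, T (onb E j)⟫_ℂ

end Trace

variable {H : Type*} [NormedAddCommGroup H] [InnerProductSpace ℂ H] [CompleteSpace H]

/-! ### The trace class -/

/-- `A` is trace class: it has a Schmidt decomposition `A = ∑ⱼ sⱼ |fⱼ⟩⟨gⱼ|` with orthonormal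
systems `f`, `g`, indexed by some `N ⊆ ℕ`, and with summable singular values `sⱼ > 0`. -/
def IsTraceClass (A : H →L[ℂ] H) : Prop :=
  ∃ (N : Set ℕ) (s : N → ℝ) (f g : N → H),
    (∀ j, 0 < s j) ∧ Orthonormal ℂ f ∧ Orthonormal ℂ g ∧ Summable s ∧
      ∀ x, HasSum (fun j => ((s j : ℂ) * ⟪g j, x⟫_ℂ) • f j) (A x)

/-- `A = ∑ₙ |xₙ⟩⟨yₙ|` with `∑ₙ ‖xₙ‖ ‖yₙ‖ < ∞`. Auxiliary: it is equivalent to `IsTraceClass`, which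
is how the trace class is seen to be a two-sided ideal. -/
def HasNuclearSum {ι : Type*} (A : H →L[ℂ] H) (x y : ι → H) : Prop :=
  Summable (fun n => ‖x n‖ * ‖y n‖) ∧ ∀ z, HasSum (fun n => ⟪y n, z⟫_ℂ • x n) (A z)

lemma IsTraceClass.exists_nuclear {A : H →L[ℂ] H} (hA : IsTraceClass A) :
    ∃ (N : Set ℕ) (x y : N → H), HasNuclearSum A x y := by
  obtain ⟨N, s, f, g, hs, hf, hg, hsum, h⟩ := hA
  refine ⟨N, fun j => (s j : ℂ) • f j, g, ?_, fun z => ?_⟩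
  · convert hsum using 2 with j
    simp [norm_smul, hf.1, hg.1, abs_of_pos (hs j)]
  · convert h z using 2 with j
    rw [smul_smul, mul_comm]

/-- Orthonormal systems see a nuclear operator through an absolutely summable family. -/
lemma HasNuclearSum.summable_inner {ι κ : Type*} {A : H →L[ℂ] H} {x y : ι → H}
    (h : HasNuclearSum A x y) {e f : κ → H} (he : Orthonormal ℂ e) (hf : Orthonormal ℂ f) :
    Summable (fun k => ‖⟪e k, A (f k)⟫_ℂ‖) := by
  refine summable_of_sum_le (c := ∑' n, ‖x n‖ * ‖y n‖) (fun _ => norm_nonneg _) fun F => ?_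
  have key : ∀ k n, ‖⟪e k, ⟪y n, f k⟫_ℂ • x n⟫_ℂ‖ ≤ ‖x n‖ * ‖y n‖ := fun k n => by
    rw [inner_smul_right, norm_mul, mul_comm]
    have h1 := norm_inner_le_norm (𝕜 := ℂ) (e k) (x n)
    have h2 := norm_inner_le_norm (𝕜 := ℂ) (y n) (f k)
    rw [he.1, one_mul] at h1
    rw [hf.1, mul_one] at h2
    gcongr
  have hsm : ∀ k, Summable fun n => ‖⟪e k, ⟪y n, f k⟫_ℂ • x n⟫_ℂ‖ := fun k =>
    Summable.of_nonneg_of_le (fun _ => norm_nonneg _) (key k) h.1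
  calc ∑ k ∈ F, ‖⟪e k, A (f k)⟫_ℂ‖
      ≤ ∑ k ∈ F, ∑' n, ‖⟪e k, ⟪y n, f k⟫_ℂ • x n⟫_ℂ‖ := by
        refine Finset.sum_le_sum fun k _ => ?_
        have := (innerSL ℂ (e k)).hasSum (h.2 (f k))
        simp only [innerSL_apply_apply] at this
        rw [← this.tsum_eq]
        exact norm_tsum_le_tsum_norm (hsm k)
    _ = ∑' n, ∑ k ∈ F, ‖⟪e k, ⟪y n, f k⟫_ℂ • x n⟫_ℂ‖ :=
        (Summable.tsum_finsetSum fun k _ => hsm k).symm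
    _ ≤ ∑' n, ‖x n‖ * ‖y n‖ := by
        refine Summable.tsum_le_tsum (fun n => ?_) (summable_sum fun k _ => hsm k) h.1
        have h1 := he.sum_inner_products_le (x n) (s := F)
        have h2 := hf.sum_inner_products_le (y n) (s := F)
        calc ∑ k ∈ F, ‖⟪e k, ⟪y n, f k⟫_ℂ • x n⟫_ℂ‖
            = ∑ k ∈ F, ‖⟪e k, x n⟫_ℂ‖ * ‖⟪f k, y n⟫_ℂ‖ := by
              refine Finset.sum_congr rfl fun k _ => ?_
              rw [inner_smul_right, norm_mul, mul_comm, norm_inner_symm (y n)]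
          _ ≤ √(∑ k ∈ F, ‖⟪e k, x n⟫_ℂ‖ ^ 2) * √(∑ k ∈ F, ‖⟪f k, y n⟫_ℂ‖ ^ 2) :=
              Real.sum_mul_le_sqrt_mul_sqrt _ _ _
          _ ≤ ‖x n‖ * ‖y n‖ := by
              gcongr
              · exact Real.sqrt_le_iff.2 ⟨norm_nonneg _, h1⟩
              · exact Real.sqrt_le_iff.2 ⟨norm_nonneg _, h2⟩

lemma HasNuclearSum.isCompactOperator {ι : Type*} {A : H →L[ℂ] H} {x y : ι → H}
    (h : HasNuclearSum A x y) : IsCompactOperator A := by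
  have hsum : Summable fun n => InnerProductSpace.rankOne ℂ (x n) (y n) :=
    Summable.of_norm (by simpa using h.1)
  obtain ⟨T, hT⟩ := hsum
  have hTA : T = A := by
    ext z
    exact HasSum.unique ((ContinuousLinearMap.apply ℂ H z).hasSum hT) (h.2 z)
  subst hTA
  refine isCompactOperator_of_tendsto hT (Filter.Eventually.of_forall fun F => ?_)
  refine Submodule.sum_mem (compactOperator (RingHom.id ℂ) H H) fun n _ => ?_
  have : IsCompactOperator (ContinuousLinearMap.toSpanSingleton ℂ (x n) : ℂ →L[ℂ] H) := by
    have h1 : IsCompactOperator (id : ℂ → ℂ) :=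
      (isCompactOperator_id_iff_finiteDimensional (𝕜 := ℂ)).2 inferInstance
    exact h1.clm_comp (ContinuousLinearMap.toSpanSingleton ℂ (x n))
  exact this.comp_clm (innerSL ℂ (y n))

/-- A compact operator maps some orthonormal basis to an orthogonal family. -/
lemma exists_hilbertBasis_orthogonal_image {A : H →L[ℂ] H} (hA : IsCompactOperator A) :
    ∃ (w : Set H) (b : HilbertBasis w ℂ H), ∀ i j, i ≠ j → ⟪A (b i), A (b j)⟫_ℂ = 0 := by
  set T : H →L[ℂ] H := ContinuousLinearMap.adjoint A ∘L A with hTdef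
  have hTc : IsCompactOperator T := hA.clm_comp (ContinuousLinearMap.adjoint A)
  have hTs : (T : H →ₗ[ℂ] H).IsSymmetric := fun x y => by
    simp [hTdef, ContinuousLinearMap.adjoint_inner_left, ContinuousLinearMap.adjoint_inner_right]
  have hcl : ∀ μ : ℂ, CompleteSpace (Module.End.eigenspace (T : H →ₗ[ℂ] H) μ) := fun μ => by
    have : IsClosed (Module.End.eigenspace (T : H →ₗ[ℂ] H) μ : Set H) := by
      have : (Module.End.eigenspace (T : H →ₗ[ℂ] H) μ : Set H) = {x | T x = μ • x} := by
        ext x; simp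
      rw [this]
      exact isClosed_eq T.continuous (continuous_const_smul μ)
    exact this.completeSpace_coe
  choose w v hv using fun μ : ℂ =>
    exists_hilbertBasis ℂ (Module.End.eigenspace (T : H →ₗ[ℂ] H) μ)
  have hon := hTs.orthogonalFamily_eigenspaces.orthonormal_sigma_orthonormal
    fun μ => (v μ).orthonormal
  set e : (Σ μ : ℂ, w μ) → H := fun a => (v a.1 a.2 : H) with he
  have hon' : Orthonormal ℂ e := hon
  have hperp : (Submodule.span ℂ (Set.range ((↑) : Set.range e → H)))ᗮ = ⊥ := by
    rw [Subtype.range_coe, eq_bot_iff,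
      ← ContinuousLinearMap.orthogonalComplement_iSup_eigenspaces_eq_bot hTc hTs]
    intro z hz
    rw [Submodule.mem_orthogonal] at hz
    rw [Submodule.mem_orthogonal']
    intro u hu
    refine Submodule.iSup_induction _ (motive := fun u => ⟪z, u⟫_ℂ = 0) hu ?_ (by simp) ?_
    · intro μ u hu
      have h1 := (v μ).hasSum_repr ⟨u, hu⟩
      have h2 := (innerSL ℂ z).hasSum
        ((Module.End.eigenspace (T : H →ₗ[ℂ] H) μ).subtypeL.hasSum h1)
      have h3 : ∀ i, innerSL ℂ z ((Module.End.eigenspace (T : H →ₗ[ℂ] H) μ).subtypeL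
          ((v μ).repr ⟨u, hu⟩ i • v μ i)) = 0 := fun i => by
        have := hz _ (Submodule.subset_span ⟨⟨μ, i⟩, rfl⟩)
        rw [inner_eq_zero_symm] at this
        simp only [Submodule.subtypeL_apply, Submodule.coe_smul, innerSL_apply_apply, inner_smul_right]
        exact mul_eq_zero_of_right _ this
      simp only [h3] at h2
      exact h2.unique hasSum_zero
    · intro a c ha hc
      simp [ha, hc]
  refine ⟨Set.range e, HilbertBasis.mkOfOrthogonalEqBot hon'.toSubtypeRange hperp, ?_⟩
  rintro ⟨_, i, rfl⟩ ⟨_, j, rfl⟩ hij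
  have hij' : i ≠ j := fun h => hij (by subst h; rfl)
  simp only [HilbertBasis.coe_mkOfOrthogonalEqBot]
  have hTj : T (e j) = j.1 • e j :=
    Module.End.mem_eigenspace_iff.1 (v j.1 j.2).2
  rw [← ContinuousLinearMap.adjoint_inner_right]
  change ⟪e i, T (e j)⟫_ℂ = 0
  rw [hTj, inner_smul_right, hon'.2 hij', mul_zero]

lemma HasNuclearSum.isTraceClass {ι : Type*} {A : H →L[ℂ] H} {x y : ι → H}
    (h : HasNuclearSum A x y) : IsTraceClass A := by
  obtain ⟨w, b, hb⟩ := exists_hilbertBasis_orthogonal_image h.isCompactOperator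
  let J : Type _ := {i : w // A (b i) ≠ 0}
  let s : J → ℝ := fun i => ‖A (b i.1)‖
  have hs : ∀ i, 0 < s i := fun i => norm_pos_iff.2 i.2
  let f : J → H := fun i => (s i : ℂ)⁻¹ • A (b i.1)
  let g : J → H := fun i => b i.1
  have hsf : ∀ i, (s i : ℂ) • f i = A (b i.1) := fun i => by
    have : (s i : ℂ) ≠ 0 := by exact_mod_cast (hs i).ne'
    simp [f, smul_smul, this]
  have hg : Orthonormal ℂ g := b.orthonormal.comp _ Subtype.val_injective
  have hf : Orthonormal ℂ f := by
    constructor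
    · intro i
      simp only [f, norm_smul, norm_inv, Complex.norm_real, Real.norm_eq_abs, abs_of_pos (hs i)]
      exact inv_mul_cancel₀ (hs i).ne'
    · intro i j hij
      simp [f, inner_smul_left, inner_smul_right, hb _ _ (fun h => hij (Subtype.ext h))]
  have hsum : Summable s := by
    have := h.summable_inner hf hg
    refine this.congr fun i => ?_
    simp only [f, g, inner_smul_left, inner_self_eq_norm_sq_to_K]
    have := hs i
    simp only [norm_mul, map_inv₀, Complex.conj_ofReal, norm_inv, Complex.norm_real, norm_pow,
      Real.norm_eq_abs, abs_of_pos (hs i)]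
    change _ * (‖((s i : ℝ) : ℂ)‖) ^ 2 = _
    simp only [Complex.norm_real, Real.norm_eq_abs, abs_of_pos (hs i)]
    field_simp
  have hcount : Countable J := by
    have := hsum.countable_support
    rw [show Function.support s = Set.univ from
      Set.eq_univ_of_forall fun i => (hs i).ne'] at this
    exact Set.countable_univ_iff.1 this
  obtain ⟨φ, hφ⟩ := exists_injective_nat J
  let e : J ≃ Set.range φ := Equiv.ofInjective φ hφ
  refine ⟨Set.range φ, s ∘ e.symm, f ∘ e.symm, g ∘ e.symm, fun j => hs _,
    hf.comp _ e.symm.injective, hg.comp _ e.symm.injective,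
    (Equiv.summable_iff e.symm).2 hsum, fun z => ?_⟩
  have h1 : HasSum (fun i => ⟪b i, z⟫_ℂ • A (b i)) (A z) := by
    have := A.hasSum (b.hasSum_repr z)
    simpa [HilbertBasis.repr_apply_apply] using this
  have h2 : HasSum (fun i : J => ⟪b i.1, z⟫_ℂ • A (b i.1)) (A z) := by
    refine (hasSum_subtype_iff_of_support_subset (s := {i | A (b i) ≠ 0}) ?_).2 h1
    intro i hi
    simp only [Function.mem_support] at hi
    exact fun h0 => hi (by simp [h0])
  refine (Equiv.hasSum_iff (f := fun i : J => ((s i : ℂ) * ⟪g i, z⟫_ℂ) • f i) e.symm).2 ?_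
  convert h2 using 2 with i
  rw [mul_comm, ← smul_smul, hsf i]

lemma HasNuclearSum.clm_comp {ι : Type*} {A : H →L[ℂ] H} {x y : ι → H}
    (h : HasNuclearSum A x y) (K : H →L[ℂ] H) :
    HasNuclearSum (K ∘L A) (fun n => K (x n)) y := by
  refine ⟨Summable.of_nonneg_of_le (fun n => by positivity) (fun n => ?_) (h.1.mul_left ‖K‖),
    fun z => ?_⟩
  · rw [← mul_assoc]
    gcongr
    exact K.le_opNorm _
  · simpa using K.hasSum (h.2 z)

lemma HasNuclearSum.comp_clm {ι : Type*} {A : H →L[ℂ] H} {x y : ι → H}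
    (h : HasNuclearSum A x y) (K : H →L[ℂ] H) :
    HasNuclearSum (A ∘L K) x (fun n => ContinuousLinearMap.adjoint K (y n)) := by
  refine ⟨Summable.of_nonneg_of_le (fun n => by positivity) (fun n => ?_)
    (h.1.mul_left ‖ContinuousLinearMap.adjoint K‖), fun z => ?_⟩
  · rw [mul_left_comm]
    gcongr
    exact ContinuousLinearMap.le_opNorm _ _
  · simpa [ContinuousLinearMap.adjoint_inner_left] using h.2 (K z)

lemma IsTraceClass.clm_comp {A : H →L[ℂ] H} (hA : IsTraceClass A) (K : H →L[ℂ] H) :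
    IsTraceClass (K ∘L A) :=
  let ⟨_, _, _, h⟩ := hA.exists_nuclear
  (h.clm_comp K).isTraceClass

lemma IsTraceClass.comp_clm {A : H →L[ℂ] H} (hA : IsTraceClass A) (K : H →L[ℂ] H) :
    IsTraceClass (A ∘L K) :=
  let ⟨_, _, _, h⟩ := hA.exists_nuclear
  (h.comp_clm K).isTraceClass

lemma IsTraceClass.zero : IsTraceClass (0 : H →L[ℂ] H) :=
  HasNuclearSum.isTraceClass (ι := Empty) (x := Empty.elim) (y := Empty.elim)
    ⟨summable_empty, fun _ => hasSum_empty⟩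

lemma IsTraceClass.add {A C : H →L[ℂ] H} (hA : IsTraceClass A) (hC : IsTraceClass C) :
    IsTraceClass (A + C) := by
  obtain ⟨N, x, y, h⟩ := hA.exists_nuclear
  obtain ⟨M, x', y', h'⟩ := hC.exists_nuclear
  refine HasNuclearSum.isTraceClass (ι := N ⊕ M) (x := Sum.elim x x') (y := Sum.elim y y')
    ⟨Summable.sum _ h.1 h'.1, fun z => ?_⟩
  exact HasSum.sum (h.2 z) (h'.2 z)

variable (H) in
/-- The trace class `𝓑¹(H)`. -/
def TraceClass : Submodule ℂ (H →L[ℂ] H) where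
  carrier := {A | IsTraceClass A}
  zero_mem' := IsTraceClass.zero
  add_mem' := IsTraceClass.add
  smul_mem' c A hA := by
    have := IsTraceClass.clm_comp hA (c • ContinuousLinearMap.id ℂ H)
    simpa using this

/-! ### The Hilbert space of Hilbert-Schmidt operators -/

/-- `A` is Hilbert-Schmidt: `∑ⱼ ‖A gⱼ‖² < ∞` for an orthonormal basis `g`. -/
def IsHilbertSchmidt (A : H →L[ℂ] H) : Prop := Summable fun j => ‖A (onb H j)‖ ^ 2

lemma isHilbertSchmidt_iff_memℓp {A : H →L[ℂ] H} :
    IsHilbertSchmidt A ↔ Memℓp (fun j => A (onb H j)) 2 := by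
  rw [memℓp_gen_iff (by simp)]
  simp [IsHilbertSchmidt]

lemma IsTraceClass.isHilbertSchmidt {A : H →L[ℂ] H} (hA : IsTraceClass A) :
    IsHilbertSchmidt A := by
  obtain ⟨_, _, _, h⟩ := hA.exists_nuclear
  have := (h.clm_comp (ContinuousLinearMap.adjoint A)).summable_inner
    (onb H).orthonormal (onb H).orthonormal
  refine this.congr fun j => ?_
  simp [ContinuousLinearMap.adjoint_inner_right]

variable (H) in
/-- The Hilbert-Schmidt operators as a subspace of `𝓑(H)`. -/
def hilbertSchmidtSubmodule : Submodule ℂ (H →L[ℂ] H) where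
  carrier := {A | IsHilbertSchmidt A}
  zero_mem' := by simp [IsHilbertSchmidt, summable_zero]
  add_mem' {A C} hA hC := by
    have := (isHilbertSchmidt_iff_memℓp.1 hA).add (isHilbertSchmidt_iff_memℓp.1 hC)
    exact isHilbertSchmidt_iff_memℓp.2 this
  smul_mem' c A hA := by
    have := (isHilbertSchmidt_iff_memℓp.1 hA).const_smul c
    exact isHilbertSchmidt_iff_memℓp.2 this

variable (H) in
/-- The Hilbert-Schmidt class `𝓑²(H)`; it carries the Hilbert-Schmidt inner product
`⟨X, Y⟩ = tr(X* Y)` and the norm that comes from it, not the operator norm. -/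
def HilbertSchmidt : Type _ := hilbertSchmidtSubmodule H

namespace HilbertSchmidt

instance : AddCommGroup (HilbertSchmidt H) :=
  inferInstanceAs (AddCommGroup (hilbertSchmidtSubmodule H))

instance : Module ℂ (HilbertSchmidt H) :=
  inferInstanceAs (Module ℂ (hilbertSchmidtSubmodule H))

variable (H) in
/-- The inclusion `𝓑²(H) ⊆ 𝓑(H)`. -/
def toCLM : HilbertSchmidt H →ₗ[ℂ] (H →L[ℂ] H) := (hilbertSchmidtSubmodule H).subtype

lemma toCLM_injective : Function.Injective (toCLM H) :=
  (hilbertSchmidtSubmodule H).injective_subtype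

lemma isHilbertSchmidt_toCLM (X : HilbertSchmidt H) : IsHilbertSchmidt (toCLM H X) := X.2

variable (H) in
/-- The map `X ↦ (X gⱼ)ⱼ` to the `ℓ²`-space of families in `H`. -/
def toLp : HilbertSchmidt H →ₗ[ℂ] lp (fun _ : onbIndex H => H) 2 where
  toFun X := ⟨fun j => toCLM H X (onb H j),
    isHilbertSchmidt_iff_memℓp.1 (isHilbertSchmidt_toCLM X)⟩
  map_add' _ _ := rfl
  map_smul' _ _ := rfl

lemma toLp_injective : Function.Injective (toLp H) := by
  intro X Y h
  apply toCLM_injective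
  have h' : ∀ j, toCLM H X (onb H j) = toCLM H Y (onb H j) := fun j =>
    congrFun (congrArg Subtype.val h) j
  ext z
  have h1 := (toCLM H X).hasSum ((onb H).hasSum_repr z)
  have h2 := (toCLM H Y).hasSum ((onb H).hasSum_repr z)
  simp only [map_smul, h'] at h1 h2
  exact h1.unique h2

/-- The Hilbert-Schmidt inner product `tr(X* Y)`. -/
def hsInner (X Y : HilbertSchmidt H) : ℂ :=
  trace ((ContinuousLinearMap.adjoint (toCLM H X) ∘L toCLM H Y : H →L[ℂ] H) : H →ₗ[ℂ] H)

lemma hsInner_eq_toLp (X Y : HilbertSchmidt H) : hsInner X Y = ⟪toLp H X, toLp H Y⟫_ℂ := by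
  rw [hsInner, lp.inner_eq_tsum, trace]
  simp only [ContinuousLinearMap.coe_coe, ContinuousLinearMap.comp_apply,
    ContinuousLinearMap.adjoint_inner_right]
  rfl

variable (H) in
/-- `tr(X* Y)` is an inner product. -/
@[reducible]
def core : InnerProductSpace.Core ℂ (HilbertSchmidt H) where
  inner := hsInner
  conj_inner_symm X Y := by
    rw [hsInner_eq_toLp, hsInner_eq_toLp, inner_conj_symm]
  re_inner_nonneg X := by
    rw [hsInner_eq_toLp]
    exact inner_self_nonneg
  add_left X Y Z := by
    simp only [hsInner_eq_toLp, map_add, inner_add_left]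
  smul_left X Y c := by
    simp only [hsInner_eq_toLp, map_smul, inner_smul_left]
  definite X h := by
    rw [hsInner_eq_toLp, inner_self_eq_zero] at h
    exact toLp_injective (h.trans (map_zero _).symm)

instance : NormedAddCommGroup (HilbertSchmidt H) := (core H).toNormedAddCommGroup

instance : InnerProductSpace ℂ (HilbertSchmidt H) := InnerProductSpace.ofCore (core H).toCore

lemma inner_def (X Y : HilbertSchmidt H) : ⟪X, Y⟫_ℂ =
    trace ((ContinuousLinearMap.adjoint (toCLM H X) ∘L toCLM H Y : H →L[ℂ] H) : H →ₗ[ℂ] H) := rfl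

lemma norm_toLp (X : HilbertSchmidt H) : ‖toLp H X‖ = ‖X‖ := by
  rw [@norm_eq_sqrt_re_inner ℂ, @norm_eq_sqrt_re_inner ℂ, ← hsInner_eq_toLp]
  rfl

lemma toLp_surjective : Function.Surjective (toLp H) := by
  intro h
  have hh : Summable fun j => ‖h j‖ ^ 2 := by
    have := lp.memℓp h
    rw [memℓp_gen_iff (by simp)] at this
    simpa using this
  set C : ℝ := √(∑' j, ‖h j‖ ^ 2) with hC
  have hF : ∀ (z : H) (F : Finset (onbIndex H)),
      ∑ j ∈ F, ‖⟪onb H j, z⟫_ℂ • h j‖ ≤ C * ‖z‖ := fun z F => by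
    calc ∑ j ∈ F, ‖⟪onb H j, z⟫_ℂ • h j‖
        = ∑ j ∈ F, ‖h j‖ * ‖⟪onb H j, z⟫_ℂ‖ :=
          Finset.sum_congr rfl fun j _ => by rw [norm_smul, mul_comm]
      _ ≤ √(∑ j ∈ F, ‖h j‖ ^ 2) * √(∑ j ∈ F, ‖⟪onb H j, z⟫_ℂ‖ ^ 2) :=
          Real.sum_mul_le_sqrt_mul_sqrt _ _ _
      _ ≤ C * ‖z‖ := by
          gcongr
          · exact Real.sqrt_le_sqrt (hh.sum_le_tsum F fun _ _ => by positivity)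
          · exact Real.sqrt_le_iff.2
              ⟨norm_nonneg _, (onb H).orthonormal.sum_inner_products_le z⟩
  have hn : ∀ z : H, Summable fun j => ‖⟪onb H j, z⟫_ℂ • h j‖ := fun z =>
    summable_of_sum_le (fun _ => norm_nonneg _) (hF z)
  have hs : ∀ z : H, Summable fun j => ⟪onb H j, z⟫_ℂ • h j := fun z => (hn z).of_norm
  let T : H →L[ℂ] H := LinearMap.mkContinuous
    { toFun := fun z => ∑' j, ⟪onb H j, z⟫_ℂ • h j
      map_add' := fun x y => by
        simp only [inner_add_right, add_smul]
        exact (hs x).tsum_add (hs y)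
      map_smul' := fun c x => by
        simp only [inner_smul_right, mul_smul, RingHom.id_apply]
        exact (hs x).tsum_const_smul c } C fun z =>
      (norm_tsum_le_tsum_norm (hn z)).trans (Real.tsum_le_of_sum_le (fun _ => norm_nonneg _) (hF z))
  have hT : ∀ k, T (onb H k) = h k := fun k => by
    change ∑' j, ⟪onb H j, onb H k⟫_ℂ • h j = h k
    rw [tsum_eq_single k fun j hj => by rw [(onb H).orthonormal.2 hj, zero_smul]]
    simp [(onb H).orthonormal.1 k]
  refine ⟨⟨T, isHilbertSchmidt_iff_memℓp.2 ?_⟩, ?_⟩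
  · simp only [hT]
    exact lp.memℓp h
  · ext k
    exact hT k

instance : CompleteSpace (HilbertSchmidt H) := by
  let e : HilbertSchmidt H ≃ₗᵢ[ℂ] lp (fun _ : onbIndex H => H) 2 :=
    { LinearEquiv.ofBijective (toLp H) ⟨toLp_injective, toLp_surjective⟩ with
      norm_map' := norm_toLp }
  exact e.symm.toIsometryEquiv.completeSpace_iff.1 inferInstance

end HilbertSchmidt

/-- The inclusion `𝓑¹(H) ⊆ 𝓑²(H)`. -/
def TraceClass.toHilbertSchmidt : TraceClass H →ₗ[ℂ] HilbertSchmidt H :=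
  Submodule.inclusion (p := TraceClass H) (p' := hilbertSchmidtSubmodule H)
    fun _ hA => IsTraceClass.isHilbertSchmidt hA

/-! ### Superoperators -/

/-- The map `X ↦ B* X B` from `𝓑²(H)` to `𝓑¹(H)`, for `B` trace class. -/
def sandwich (B : TraceClass H) : HilbertSchmidt H →ₗ[ℂ] TraceClass H where
  toFun X := ⟨ContinuousLinearMap.adjoint (B : H →L[ℂ] H) ∘L HilbertSchmidt.toCLM H X ∘L
    (B : H →L[ℂ] H), (IsTraceClass.clm_comp B.2 _).clm_comp _⟩
  map_add' X Y := by ext z; simp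
  map_smul' c X := by ext z; simp

/-- The map `Φ(B* (·) B)` on the Hilbert space `𝓑²(H)`. -/
def weighted (Φ : TraceClass H →ₗ[ℂ] TraceClass H) (B : TraceClass H) :
    HilbertSchmidt H →ₗ[ℂ] HilbertSchmidt H :=
  TraceClass.toHilbertSchmidt ∘ₗ Φ ∘ₗ sandwich B

/-- The map `A ↦ K A + A K*` on `𝓑¹(H)`. -/
def leftRight (K : H →L[ℂ] H) : TraceClass H →ₗ[ℂ] TraceClass H where
  toFun A := ⟨K ∘L (A : H →L[ℂ] H) + (A : H →L[ℂ] H) ∘L ContinuousLinearMap.adjoint K,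
    (IsTraceClass.clm_comp A.2 _).add (IsTraceClass.comp_clm A.2 _)⟩
  map_add' A C := by ext z; simp; abel
  map_smul' c A := by ext z; simp

/-- The operator on `ℂⁿ ⊗ H = H × ⋯ × H` (with the `ℓ²` norm) given by an `n × n` matrix of
operators on `H`. -/
def blockOp {n : ℕ} (A : Matrix (Fin n) (Fin n) (H →L[ℂ] H)) :
    PiLp 2 (fun _ : Fin n => H) →L[ℂ] PiLp 2 (fun _ : Fin n => H) :=
  ((PiLp.continuousLinearEquiv 2 ℂ (fun _ : Fin n => H)).symm :
      (Fin n → H) →L[ℂ] PiLp 2 (fun _ : Fin n => H)) ∘L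
    ContinuousLinearMap.pi fun i => ∑ j, A i j ∘L PiLp.proj 2 (fun _ : Fin n => H) j

/-- `Φ` is `n`-positive: `idₙ ⊗ Φ`, which applies `Φ` to every entry of an `n × n` matrix of
trace-class operators, preserves positive semidefiniteness. -/
def IsNPositive (n : ℕ) (Φ : TraceClass H →ₗ[ℂ] TraceClass H) : Prop :=
  ∀ A : Matrix (Fin n) (Fin n) (TraceClass H),
    (blockOp (A.map fun a => (a : H →L[ℂ] H))).IsPositive →
      (blockOp (A.map fun a => (Φ a : H →L[ℂ] H))).IsPositive

/-- The set `CP(H)` of completely positive linear maps on `𝓑¹(H)`. -/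
def CP (H : Type*) [NormedAddCommGroup H] [InnerProductSpace ℂ H] [CompleteSpace H] :
    Set (TraceClass H →ₗ[ℂ] TraceClass H) :=
  {Φ | ∀ n, IsNPositive n Φ}

/-- The set `CP_B(H)` of all `Φ` in `CP(H)` for which the trace of `Φ(B* (·) B)`, an operator on the
Hilbert space `𝓑²(H)`, vanishes. -/
def CPWeighted (B : TraceClass H) : Set (TraceClass H →ₗ[ℂ] TraceClass H) :=
  {Φ | Φ ∈ CP H ∧ trace (weighted Φ B) = 0}

end QDyn

end

noncomputable section

namespace QDyn

set_option linter.unusedSectionVars false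

open scoped InnerProductSpace ComplexOrder
open Filter Topology

variable {H : Type*} [NormedAddCommGroup H] [InnerProductSpace ℂ H] [CompleteSpace H]

/-! ### Nuclear families and rank-one operators -/

/-! A completely positive `Φ` defines a positive form on finite sums `∑ |yᵢ⟩⟨xᵢ|`, namely `∑ᵢⱼ ⟨yᵢ,
Φ(|xᵢ⟩⟨xⱼ|) yⱼ⟩`. For a Schmidt decomposition `B = ∑ⱼ sⱼ |fⱼ⟩⟨gⱼ|`, the trace of `Φ(B* (·) B)` is
the value of this form at `B` (`CP.hasSum_trace_weighted`). If it vanishes, Cauchy-Schwarz makes `B`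
orthogonal to every `|v⟩⟨w|`: `∑ⱼ sⱼ ⟨fⱼ, Φ(|gⱼ⟩⟨w|) v⟩ = 0` (`CPWeighted.hasSum_inner_zero`).
Subtracting this for `Φ₁` and `Φ₂` gives `tr(B*K) ⟨w, v⟩ + tr(B*) ⟨Kw, v⟩ = 0`. As `tr(B*) ≠ 0`, `K`
is a scalar `c`; putting `K = c` back gives `c̄ = -c`.

The analytic difficulty is that `Φ` is only linear, with no continuity assumed, while `B` is an
infinite sum. Positivity replaces continuity: positive functionals on the trace class are
automatically countably additive (`hasSum_re_of_positive`, `HasNuclearSum.hasSum_of_positive`). This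
is used for the trace of `Φ` and for `A ↦ ⟨u, Φ(A) u⟩`. -/

lemma isPositive_of_inner_nonneg {E : Type*} [NormedAddCommGroup E] [InnerProductSpace ℂ E]
    {T : E →L[ℂ] E} (h : ∀ z, 0 ≤ ⟪z, T z⟫_ℂ) : T.IsPositive := by
  rw [ContinuousLinearMap.isPositive_iff_complex]
  intro z
  have hz : 0 ≤ ⟪T z, z⟫_ℂ := by
    rw [← inner_conj_symm (T z) z]
    exact star_nonneg_iff.2 (h z)
  obtain ⟨h1, h2⟩ := Complex.le_def.1 hz
  refine ⟨?_, h1⟩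
  apply Complex.ext
  · simp
  · simpa using h2

lemma HasNuclearSum.hasSum_inner {ι : Type*} {A : H →L[ℂ] H} {x y : ι → H}
    (h : HasNuclearSum A x y) (u v : H) :
    HasSum (fun n => ⟪y n, v⟫_ℂ * ⟪u, x n⟫_ℂ) ⟪u, A v⟫_ℂ := by
  simpa [inner_smul_right] using (innerSL ℂ u).hasSum (h.2 v)

lemma HasNuclearSum.hasSum_normSq {ι : Type*} {A : H →L[ℂ] H} {c : ι → H}
    (h : HasNuclearSum A c c) (z : H) :
    HasSum (fun n => ((‖⟪c n, z⟫_ℂ‖ ^ 2 : ℝ) : ℂ)) ⟪z, A z⟫_ℂ := by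
  convert h.hasSum_inner z z using 2 with n
  rw [← inner_conj_symm z (c n), Complex.mul_conj, Complex.normSq_eq_norm_sq]

lemma HasNuclearSum.isPositive {ι : Type*} {A : H →L[ℂ] H} {c : ι → H}
    (h : HasNuclearSum A c c) : A.IsPositive :=
  isPositive_of_inner_nonneg fun z =>
    (h.hasSum_normSq z).nonneg fun n => by exact_mod_cast (by positivity)

/-- The rank-one terms converge absolutely in operator norm. This supplies the auxiliary trace-class
operators on which positive functionals are tested. -/
lemma exists_hasNuclearSum {ι : Type*} {x y : ι → H} (h : Summable fun n => ‖x n‖ * ‖y n‖) :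
    ∃ A : TraceClass H, HasNuclearSum (A : H →L[ℂ] H) x y := by
  have hsum : Summable fun n => InnerProductSpace.rankOne ℂ (x n) (y n) :=
    Summable.of_norm (by simpa using h)
  obtain ⟨T, hT⟩ := hsum
  have hA : HasNuclearSum T x y := ⟨h, fun z => by
    simpa using (ContinuousLinearMap.apply ℂ H z).hasSum hT⟩
  exact ⟨⟨T, hA.isTraceClass⟩, hA⟩

lemma hasNuclearSum_rankOne (x y : H) :
    HasNuclearSum (InnerProductSpace.rankOne ℂ x y) (fun _ : Unit => x) (fun _ => y) :=
  ⟨Summable.of_finite, fun z => by simp⟩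

/-- The rank-one operator `|x⟩⟨y|` as an element of the trace class. -/
def ketBra (x y : H) : TraceClass H :=
  ⟨InnerProductSpace.rankOne ℂ x y, (hasNuclearSum_rankOne x y).isTraceClass⟩

@[simp]
lemma coe_ketBra (x y : H) : (ketBra x y : H →L[ℂ] H) = InnerProductSpace.rankOne ℂ x y := rfl

lemma ketBra_smul_left (c : ℂ) (x y : H) : ketBra (c • x) y = c • ketBra x y := by
  ext z; simp

lemma ketBra_smul_right (c : ℂ) (x y : H) : ketBra x (c • y) = star c • ketBra x y := by
  ext z; simp

/-- Polarization: transfers additivity from positive rank-one operators to all of them. -/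
lemma four_smul_ketBra (x y : H) : (4 : ℂ) • ketBra x y =
    ketBra (x + y) (x + y) - ketBra (x - y) (x - y)
      + Complex.I • ketBra (x + Complex.I • y) (x + Complex.I • y)
      - Complex.I • ketBra (x - Complex.I • y) (x - Complex.I • y) := by
  ext z
  simp only [SetLike.val_smul, coe_ketBra, AddSubgroupClass.coe_sub, Submodule.coe_add,
    add_apply, sub_apply, smul_apply,
    InnerProductSpace.rankOne_apply, inner_add_left, inner_sub_left, inner_smul_left,
    Complex.conj_I]
  match_scalars <;> ring_nf <;> simp only [Complex.I_sq] <;> ring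

/-- Subtracting finitely many terms from a nuclear sum removes them from the family. -/
lemma HasNuclearSum.compl {ι : Type*} [DecidableEq ι] {A : H →L[ℂ] H} {x y : ι → H}
    (h : HasNuclearSum A x y) (F : Finset ι) :
    HasNuclearSum (A - ∑ n ∈ F, InnerProductSpace.rankOne ℂ (x n) (y n))
      (fun n => if n ∈ F then 0 else x n) (fun n => if n ∈ F then 0 else y n) := by
  refine ⟨Summable.of_nonneg_of_le (fun n => by positivity) (fun n => ?_) h.1, fun z => ?_⟩
  · by_cases hn : n ∈ F
    · simp only [hn, if_true, norm_zero, mul_zero]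
      positivity
    · simp [hn]
  · have h1 : HasSum (fun n => if n ∈ F then ⟪y n, z⟫_ℂ • x n else 0)
        (∑ n ∈ F, ⟪y n, z⟫_ℂ • x n) := by
      have : HasSum (fun n => if n ∈ F then ⟪y n, z⟫_ℂ • x n else 0)
          (∑ n ∈ F, if n ∈ F then ⟪y n, z⟫_ℂ • x n else 0) :=
        hasSum_sum_of_ne_finset_zero fun n hn => by simp [hn]
      rwa [Finset.sum_congr rfl (g := fun n => ⟪y n, z⟫_ℂ • x n)
        (fun n hn => by simp [hn])] at this
    convert (h.2 z).sub h1 using 2 with n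
    · by_cases hn : n ∈ F <;> simp [hn]
    · simp

/-! ### Normality of positive functionals on the trace class -/

/-- Remainders of the series are positive, so partial sums stay below `φ A`. Were there a defect `δ
> 0`, every remainder would have value at least `δ`; summing a sequence of remainders with
geometrically small tails gives one trace-class `Q` with `φ Q ≥ m δ` for all `m`, which is absurd.
-/
lemma hasSum_re_of_positive {ι : Type*} {φ : TraceClass H →ₗ[ℂ] ℂ}
    (hφ : ∀ A : TraceClass H, (A : H →L[ℂ] H).IsPositive → 0 ≤ φ A)
    {A : TraceClass H} {c : ι → H} (h : HasNuclearSum (A : H →L[ℂ] H) c c) :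
    HasSum (fun n => (φ (ketBra (c n) (c n))).re) (φ A).re := by
  classical
  set a : ι → ℝ := fun n => (φ (ketBra (c n) (c n))).re with ha
  have ha0 : ∀ n, 0 ≤ a n := fun n =>
    (Complex.le_def.1 (hφ _ (InnerProductSpace.isPositive_rankOne_self (c n)))).1
  let R : Finset ι → TraceClass H := fun F => A - ∑ n ∈ F, ketBra (c n) (c n)
  have hR : ∀ F, HasNuclearSum (R F : H →L[ℂ] H) (fun n => if n ∈ F then 0 else c n)
      (fun n => if n ∈ F then 0 else c n) := fun F => by
    simpa [R] using h.compl F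
  have hφR : ∀ F, (φ (R F)).re = (φ A).re - ∑ n ∈ F, a n := fun F => by simp [R, ha]
  have hle : ∀ F, ∑ n ∈ F, a n ≤ (φ A).re := fun F => by
    have := (Complex.le_def.1 (hφ _ (hR F).isPositive)).1
    rw [hφR] at this
    simpa using this
  have hsum : Summable a := summable_of_sum_le ha0 hle
  suffices hge : (φ A).re ≤ ∑' n, a n by
    have := hsum.hasSum
    rwa [le_antisymm (hsum.tsum_le_of_sum_le hle) hge] at this
  by_contra! hlt
  set δ := (φ A).re - ∑' n, a n with hδ
  have hδ0 : 0 < δ := by linarith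
  have hRδ : ∀ F, δ ≤ (φ (R F)).re := fun F => by
    have := hsum.sum_le_tsum F fun n _ => ha0 n
    rw [hφR]; linarith
  have hc : Summable fun n => ‖c n‖ * ‖c n‖ := h.1
  have htail : ∀ k : ℕ, ∃ F : Finset ι,
      ∑' n, (if n ∈ F then 0 else ‖c n‖ * ‖c n‖) ≤ (1 / 2 : ℝ) ^ k := fun k => by
    have h1 := tendsto_tsum_compl_atTop_zero fun n => ‖c n‖ * ‖c n‖
    obtain ⟨F, hF⟩ := (h1.eventually_lt_const (show (0 : ℝ) < (1 / 2) ^ k by positivity)).exists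
    refine ⟨F, le_of_eq_of_le ?_ hF.le⟩
    rw [show (∑' n : {n // n ∉ F}, ‖c n‖ * ‖c n‖) =
      ∑' n : ({n | n ∉ F} : Set ι), ‖c n‖ * ‖c n‖ from rfl,
      tsum_subtype {n | n ∉ F} fun n => ‖c n‖ * ‖c n‖]
    refine tsum_congr fun n => ?_
    by_cases hn : n ∈ F <;> simp [Set.indicator, hn]
  choose F hF using htail
  -- The concatenation of the tails of `c` outside `F k`, over all `k`; it is the family of vectors
  -- behind `Q = ∑ₖ R (F k)`.
  let d : ℕ × ι → H := fun p => if p.2 ∈ F p.1 then 0 else c p.2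
  have hdn : ∀ k n, ‖d (k, n)‖ * ‖d (k, n)‖ = if n ∈ F k then 0 else ‖c n‖ * ‖c n‖ :=
    fun k n => by by_cases hn : n ∈ F k <;> simp [d, hn]
  have hd : Summable fun p => ‖d p‖ * ‖d p‖ := by
    rw [summable_prod_of_nonneg (fun p => by positivity)]
    simp only [hdn]
    refine ⟨fun k => Summable.of_nonneg_of_le (fun n => by positivity) (fun n => ?_) hc,
      Summable.of_nonneg_of_le (fun k => tsum_nonneg fun n => by positivity) hF
        (summable_geometric_of_lt_one (by norm_num) (by norm_num))⟩
    split_ifs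
    · positivity
    · exact le_rfl
  obtain ⟨Q, hQ⟩ := exists_hasNuclearSum hd
  have hQle : ∀ m : ℕ, m * δ ≤ (φ Q).re := fun m => by
    -- The quadratic form of `Q` is the sum over all `k` of the nonnegative forms of `R (F k)`, so
    -- it dominates any partial sum.
    have hpos : ((Q - ∑ k ∈ Finset.range m, R (F k) : TraceClass H) : H →L[ℂ] H).IsPositive := by
      refine isPositive_of_inner_nonneg fun z => ?_
      have h1 := (hQ.hasSum_normSq z).prod_fiberwise fun k => (hR (F k)).hasSum_normSq z
      have h2 := sum_le_hasSum (Finset.range m)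
        (fun k _ => (hR (F k)).isPositive.inner_nonneg_right z) h1
      simpa [sum_apply, inner_sub_right, inner_sum] using h2
    have h3 := (Complex.le_def.1 (hφ _ hpos)).1
    have h4 : ∑ k ∈ Finset.range m, δ ≤ ∑ k ∈ Finset.range m, (φ (R (F k))).re :=
      Finset.sum_le_sum fun k _ => hRδ _
    simp only [Finset.sum_const, Finset.card_range, nsmul_eq_mul] at h4
    simp only [map_sub, map_sum, Complex.sub_re, Complex.re_sum, Complex.zero_re] at h3
    linarith
  obtain ⟨m, hm⟩ := exists_nat_gt ((φ Q).re / δ)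
  rw [div_lt_iff₀ hδ0] at hm
  linarith [hQle m]

lemma HasNuclearSum.hasSum_of_positive_self {ι : Type*} {φ : TraceClass H →ₗ[ℂ] ℂ}
    (hφ : ∀ A : TraceClass H, (A : H →L[ℂ] H).IsPositive → 0 ≤ φ A)
    {A : TraceClass H} {c : ι → H} (h : HasNuclearSum (A : H →L[ℂ] H) c c) :
    HasSum (fun n => φ (ketBra (c n) (c n))) (φ A) := by
  have hre : ∀ C : TraceClass H, (C : H →L[ℂ] H).IsPositive → (((φ C).re : ℝ) : ℂ) = φ C :=
    fun C hC => Complex.ext (by simp) (by simpa using (Complex.le_def.1 (hφ C hC)).2)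
  have := Complex.hasSum_ofReal.2 (hasSum_re_of_positive hφ h)
  rw [hre A h.isPositive] at this
  exact this.congr_fun fun n => (hre _ (InnerProductSpace.isPositive_rankOne_self (c n))).symm

lemma summable_norm_mul_norm {ι : Type*} {x y : ι → H} (hx : Summable fun n => ‖x n‖ ^ 2)
    (hy : Summable fun n => ‖y n‖ ^ 2) : Summable fun n => ‖x n‖ * ‖y n‖ :=
  Summable.of_nonneg_of_le (fun n => by positivity)
    (fun n => by nlinarith [sq_nonneg (‖x n‖ - ‖y n‖), sq_nonneg ‖x n‖, sq_nonneg ‖y n‖])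
    (hx.add hy)

lemma summable_norm_add_sq {ι : Type*} {x y : ι → H} (hx : Summable fun n => ‖x n‖ ^ 2)
    (hy : Summable fun n => ‖y n‖ ^ 2) : Summable fun n => ‖x n + y n‖ ^ 2 :=
  Summable.of_nonneg_of_le (fun n => by positivity)
    (fun n => by
      nlinarith [norm_add_le (x n) (y n), norm_nonneg (x n + y n), sq_nonneg (‖x n‖ - ‖y n‖)])
    ((hx.add hy).mul_left 2)

/-- A positive functional on the trace class is countably additive along square-summable families
of rank-one operators. -/
lemma HasNuclearSum.hasSum_of_positive {ι : Type*} {φ : TraceClass H →ₗ[ℂ] ℂ}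
    (hφ : ∀ A : TraceClass H, (A : H →L[ℂ] H).IsPositive → 0 ≤ φ A)
    {A : TraceClass H} {x y : ι → H} (h : HasNuclearSum (A : H →L[ℂ] H) x y)
    (hx : Summable fun n => ‖x n‖ ^ 2) (hy : Summable fun n => ‖y n‖ ^ 2) :
    HasSum (fun n => φ (ketBra (x n) (y n))) (φ A) := by
  have key : ∀ w : ℂ, ‖w‖ = 1 → ∃ P : TraceClass H, HasNuclearSum (P : H →L[ℂ] H)
      (fun n => x n + w • y n) (fun n => x n + w • y n) := fun w hw => by
    have h1 := summable_norm_add_sq hx (y := fun n => w • y n) (by simpa [norm_smul, hw] using hy)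
    exact exists_hasNuclearSum (summable_norm_mul_norm h1 h1)
  obtain ⟨P₁, h₁⟩ := key 1 (by simp)
  obtain ⟨P₂, h₂⟩ := key (-1) (by simp)
  obtain ⟨P₃, h₃⟩ := key Complex.I (by simp)
  obtain ⟨P₄, h₄⟩ := key (-Complex.I) (by simp)
  simp only [one_smul, neg_smul, ← sub_eq_add_neg] at h₁ h₂ h₃ h₄
  have hA : (4 : ℂ) • A = P₁ - P₂ + Complex.I • P₃ - Complex.I • P₄ := by
    ext z
    have hz := (((h₁.2 z).sub (h₂.2 z)).add ((h₃.2 z).const_smul Complex.I)).sub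
      ((h₄.2 z).const_smul Complex.I)
    refine ((h.2 z).const_smul (4 : ℂ)).unique ?_
    refine hz.congr_fun fun n => ?_
    exact congrArg (fun C : TraceClass H => (C : H →L[ℂ] H) z) (four_smul_ketBra (x n) (y n))
  have hs := (((h₁.hasSum_of_positive_self hφ).sub (h₂.hasSum_of_positive_self hφ)).add
    ((h₃.hasSum_of_positive_self hφ).mul_left Complex.I)).sub
      ((h₄.hasSum_of_positive_self hφ).mul_left Complex.I)
  have hs' : HasSum (fun n => 4 * φ (ketBra (x n) (y n))) (4 * φ A) := by
    have h4 : 4 * φ A = φ P₁ - φ P₂ + Complex.I * φ P₃ - Complex.I * φ P₄ := by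
      simpa using congrArg φ hA
    rw [h4]
    exact hs.congr_fun fun n => by simpa using congrArg φ (four_smul_ketBra (x n) (y n))
  simpa using hs'.mul_left (4⁻¹ : ℂ)

/-! ### The trace of a nuclear operator -/

lemma sum_norm_inner_mul_le_of_orthonormal {E κ : Type*} [NormedAddCommGroup E]
    [InnerProductSpace ℂ E] {e : κ → E} (he : Orthonormal ℂ e) (x y : E) (F : Finset κ) :
    ∑ k ∈ F, ‖⟪y, e k⟫_ℂ * ⟪e k, x⟫_ℂ‖ ≤ ‖x‖ * ‖y‖ := by
  calc ∑ k ∈ F, ‖⟪y, e k⟫_ℂ * ⟪e k, x⟫_ℂ‖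
      = ∑ k ∈ F, ‖⟪e k, x⟫_ℂ‖ * ‖⟪e k, y⟫_ℂ‖ :=
        Finset.sum_congr rfl fun k _ => by rw [norm_mul, mul_comm, norm_inner_symm y]
    _ ≤ √(∑ k ∈ F, ‖⟪e k, x⟫_ℂ‖ ^ 2) * √(∑ k ∈ F, ‖⟪e k, y⟫_ℂ‖ ^ 2) :=
        Real.sum_mul_le_sqrt_mul_sqrt _ _ _
    _ ≤ ‖x‖ * ‖y‖ := by
        gcongr
        · exact Real.sqrt_le_iff.2 ⟨norm_nonneg _, he.sum_inner_products_le x⟩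
        · exact Real.sqrt_le_iff.2 ⟨norm_nonneg _, he.sum_inner_products_le y⟩

/-- If `T = ∑ₙ |xₙ⟩⟨yₙ|` with `∑ₙ ‖xₙ‖ ‖yₙ‖ < ∞`, then `tr T = ∑ₙ ⟨yₙ, xₙ⟩`. -/
lemma hasSum_trace {E ι : Type*} [NormedAddCommGroup E] [InnerProductSpace ℂ E] [CompleteSpace E]
    {T : E →ₗ[ℂ] E} {x y : ι → E} (h : Summable fun n => ‖x n‖ * ‖y n‖)
    (hT : ∀ z, HasSum (fun n => ⟪y n, z⟫_ℂ • x n) (T z)) :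
    HasSum (fun n => ⟪y n, x n⟫_ℂ) (trace T) := by
  -- Summing over the basis first gives `⟨yₙ, xₙ⟩`, summing over `n` first gives the diagonal
  -- entries of `T`. Cauchy-Schwarz and Bessel justify the exchange.
  let a : ι × onbIndex E → ℂ := fun p => ⟪y p.1, onb E p.2⟫_ℂ * ⟪onb E p.2, x p.1⟫_ℂ
  have hle := fun n F => sum_norm_inner_mul_le_of_orthonormal (onb E).orthonormal (x n) (y n) F
  have ha : Summable a := by
    refine Summable.of_norm ?_
    rw [summable_prod_of_nonneg fun p => norm_nonneg _]
    exact ⟨fun n => summable_of_sum_le (fun _ => norm_nonneg _) (hle n),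
      Summable.of_nonneg_of_le (fun n => tsum_nonneg fun _ => norm_nonneg _)
        (fun n => Real.tsum_le_of_sum_le (fun _ => norm_nonneg _) (hle n)) h⟩
  have h1 := ha.hasSum.prod_fiberwise fun n => (onb E).hasSum_inner_mul_inner (y n) (x n)
  have h2 : HasSum (a ∘ Equiv.prodComm _ _) (∑' p, a p) :=
    (Equiv.hasSum_iff (Equiv.prodComm _ _)).2 ha.hasSum
  have h3 := h2.prod_fiberwise (g := fun j => ⟪onb E j, T (onb E j)⟫_ℂ) fun j => by
    simpa [a, inner_smul_right] using (innerSL ℂ (onb E j)).hasSum (hT (onb E j))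
  rw [trace, h3.tsum_eq]
  exact h1

/-! ### Hilbert-Schmidt inner products -/

lemma HilbertSchmidt.hasSum_inner (X Y : HilbertSchmidt H) :
    HasSum (fun k => ⟪toCLM H X (onb H k), toCLM H Y (onb H k)⟫_ℂ) ⟪X, Y⟫_ℂ := by
  have h : ⟪X, Y⟫_ℂ = ⟪toLp H X, toLp H Y⟫_ℂ := hsInner_eq_toLp X Y
  rw [h]
  exact lp.hasSum_inner (toLp H X) (toLp H Y)

/-- This is `tr(|v⟩⟨u| X)`; it turns Hilbert-Schmidt pairings into matrix entries. -/
lemma HilbertSchmidt.inner_ketBra (u v : H) (X : HilbertSchmidt H) :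
    ⟪TraceClass.toHilbertSchmidt (ketBra u v), X⟫_ℂ = ⟪u, toCLM H X v⟫_ℂ := by
  refine (HilbertSchmidt.hasSum_inner _ X).unique ?_
  have h1 := (innerSL ℂ u).hasSum ((toCLM H X).hasSum ((onb H).hasSum_repr v))
  simp only [HilbertBasis.repr_apply_apply, map_smul, innerSL_apply_apply] at h1
  refine (h1.congr_fun fun k => ?_)
  have : toCLM H (TraceClass.toHilbertSchmidt (ketBra u v)) (onb H k) = ⟪v, onb H k⟫_ℂ • u := rfl
  rw [this]
  simp [mul_comm]

lemma HilbertSchmidt.norm_ketBra (u v : H) :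
    ‖TraceClass.toHilbertSchmidt (ketBra u v)‖ = ‖u‖ * ‖v‖ := by
  have h := HilbertSchmidt.inner_ketBra u v (TraceClass.toHilbertSchmidt (ketBra u v))
  have h2 : toCLM H (TraceClass.toHilbertSchmidt (ketBra u v)) v = ⟪v, v⟫_ℂ • u := rfl
  rw [h2, inner_smul_right, inner_self_eq_norm_sq_to_K, inner_self_eq_norm_sq_to_K,
    inner_self_eq_norm_sq_to_K] at h
  have h3 : ‖TraceClass.toHilbertSchmidt (ketBra u v)‖ ^ 2 = (‖u‖ * ‖v‖) ^ 2 := by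
    have : ‖TraceClass.toHilbertSchmidt (ketBra u v)‖ ^ 2 = ‖v‖ ^ 2 * ‖u‖ ^ 2 := by
      exact_mod_cast h
    rw [this]; ring
  exact (pow_left_inj₀ (norm_nonneg _) (by positivity) two_ne_zero).1 h3

/-! ### Complete positivity on rank-one operators -/

lemma inner_blockOp {n : ℕ} (M : Matrix (Fin n) (Fin n) (H →L[ℂ] H))
    (z : PiLp 2 (fun _ : Fin n => H)) :
    ⟪z, blockOp M z⟫_ℂ = ∑ i, ∑ j, ⟪z i, M i j (z j)⟫_ℂ := by
  simp [blockOp, PiLp.inner_apply, inner_sum, sum_apply]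

/-- The block matrix `(|xᵢ⟩⟨xⱼ|)` is itself the positive rank-one operator of the vector `(xᵢ)` in
`ℂⁿ ⊗ H`. -/
lemma IsNPositive.sum_inner_nonneg {n : ℕ} {Φ : TraceClass H →ₗ[ℂ] TraceClass H}
    (hΦ : IsNPositive n Φ) (x y : Fin n → H) :
    0 ≤ ∑ i, ∑ j, ⟪y i, (Φ (ketBra (x i) (x j)) : H →L[ℂ] H) (y j)⟫_ℂ := by
  have h := hΦ (fun i j => ketBra (x i) (x j)) ?_
  · have := h.inner_nonneg_right (WithLp.toLp 2 y)
    rw [inner_blockOp] at this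
    exact this
  · refine isPositive_of_inner_nonneg fun z => ?_
    have : ⟪z, blockOp (Matrix.map (fun i j => ketBra (x i) (x j))
        fun a => (a : H →L[ℂ] H)) z⟫_ℂ = star (∑ i, ⟪x i, z i⟫_ℂ) * ∑ i, ⟪x i, z i⟫_ℂ := by
      rw [inner_blockOp, star_sum, Finset.sum_mul_sum]
      refine Finset.sum_congr rfl fun i _ => Finset.sum_congr rfl fun j _ => ?_
      change ⟪z i, InnerProductSpace.rankOne ℂ (x i) (x j) (z j)⟫_ℂ = _
      simp [mul_comm]
    rw [this]
    exact star_mul_self_nonneg _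

lemma CP.sum_inner_nonneg {ι : Type*} [Fintype ι] {Φ : TraceClass H →ₗ[ℂ] TraceClass H}
    (hΦ : Φ ∈ CP H) (x y : ι → H) :
    0 ≤ ∑ i, ∑ j, ⟪y i, (Φ (ketBra (x i) (x j)) : H →L[ℂ] H) (y j)⟫_ℂ := by
  let e := Fintype.equivFin ι
  have := (hΦ (Fintype.card ι)).sum_inner_nonneg (x ∘ e.symm) (y ∘ e.symm)
  rw [← e.symm.sum_comp]
  simp_rw [← e.symm.sum_comp (fun j => ⟪y _, (Φ (ketBra (x _) (x j)) : H →L[ℂ] H) (y j)⟫_ℂ)]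
  exact this

lemma CP.isPositive {Φ : TraceClass H →ₗ[ℂ] TraceClass H} (hΦ : Φ ∈ CP H) {A : TraceClass H}
    (hA : (A : H →L[ℂ] H).IsPositive) : (Φ A : H →L[ℂ] H).IsPositive := by
  have h := hΦ 1 (fun _ _ => A) ?_
  · refine isPositive_of_inner_nonneg fun z => ?_
    have := h.inner_nonneg_right (WithLp.toLp 2 fun _ => z)
    rw [inner_blockOp] at this
    simp only [Fin.sum_univ_one] at this
    exact this
  · refine isPositive_of_inner_nonneg fun z => ?_
    rw [inner_blockOp]
    simp only [Fin.sum_univ_one]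
    exact hA.inner_nonneg_right (z 0)

/-- The values `t = 0, ±1, i` force `b' = b̄` and `d` real; along `t = r b̄` with `r` real, the
expression is a real quadratic whose discriminant is nonpositive. -/
lemma norm_sq_le_mul_of_forall_nonneg {a b b' d : ℂ} (hd0 : 0 ≤ d.re)
    (h : ∀ t : ℂ, 0 ≤ a + t * b + star t * b' + star t * t * d) : ‖b‖ ^ 2 ≤ a.re * d.re := by
  have h0 := (Complex.le_def.1 (h 0)).2
  have h1 := (Complex.le_def.1 (h 1)).2
  have h2 := (Complex.le_def.1 (h (-1))).2
  have h3 := (Complex.le_def.1 (h Complex.I)).2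
  simp at h0 h1 h2 h3
  have hb : b' = star b := Complex.ext (by simp; linarith) (by simp; linarith)
  have hd : d.im = 0 := by linarith
  have key : ∀ r : ℝ, 0 ≤ (‖b‖ ^ 2 * d.re) * (r * r) + (2 * ‖b‖ ^ 2) * r + a.re := fun r => by
    have hr := (Complex.le_def.1 (h (r * star b))).1
    rw [← Complex.normSq_eq_norm_sq, Complex.normSq_apply]
    simp [hb, hd] at hr
    linarith
  have := discrim_le_zero key
  rw [discrim] at this
  -- The discriminant bound carries a factor `‖b‖ ^ 2` on both sides, so it says nothing at `b = 0`;
  -- there the signs of `a.re` and `d.re` decide.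
  rcases eq_or_ne b 0 with rfl | hb0
  · have := mul_nonneg (key 0) hd0
    simpa using this
  · have : 0 < ‖b‖ ^ 2 := by positivity
    nlinarith

/-- Cauchy-Schwarz for the positive form `∑ᵢⱼ ⟨yᵢ, Φ(|xᵢ⟩⟨xⱼ|) yⱼ⟩`. -/
lemma CP.norm_sum_inner_sq_le {ι : Type*} [Fintype ι] {Φ : TraceClass H →ₗ[ℂ] TraceClass H}
    (hΦ : Φ ∈ CP H) (x y : ι → H) (w v : H) :
    ‖∑ i, ⟪y i, (Φ (ketBra (x i) w) : H →L[ℂ] H) v⟫_ℂ‖ ^ 2 ≤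
      (∑ i, ∑ j, ⟪y i, (Φ (ketBra (x i) (x j)) : H →L[ℂ] H) (y j)⟫_ℂ).re *
        (⟪v, (Φ (ketBra w w) : H →L[ℂ] H) v⟫_ℂ).re := by
  refine norm_sq_le_mul_of_forall_nonneg
    (b' := ∑ j, ⟪v, (Φ (ketBra w (x j)) : H →L[ℂ] H) (y j)⟫_ℂ)
    ((CP.isPositive hΦ (InnerProductSpace.isPositive_rankOne_self w)).re_inner_nonneg_right v)
    fun t => ?_
  -- Adjoining the pair `(w, t • v)` to the family expands the form into a quadratic polynomial in
  -- `t`.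
  have h := CP.sum_inner_nonneg hΦ (fun o : Option ι => o.elim w x)
    (fun o : Option ι => o.elim (t • v) y)
  convert h using 1
  simp only [Fintype.sum_option, Option.elim_none, Option.elim_some, map_smul, inner_smul_left,
    inner_smul_right, Finset.sum_add_distrib, ← Finset.mul_sum]
  simp only [starRingEnd_apply]
  ring

lemma CP.norm_inner_sq_le {Φ : TraceClass H →ₗ[ℂ] TraceClass H}
    (hΦ : Φ ∈ CP H) (x y u v : H) :
    ‖⟪u, (Φ (ketBra x y) : H →L[ℂ] H) v⟫_ℂ‖ ^ 2 ≤
      (⟪u, (Φ (ketBra x x) : H →L[ℂ] H) u⟫_ℂ).re * (⟪v, (Φ (ketBra y y) : H →L[ℂ] H) v⟫_ℂ).re := by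
  simpa using CP.norm_sum_inner_sq_le hΦ (fun _ : Unit => x) (fun _ => u) y v

/-! ### The trace as a positive functional -/

lemma TraceClass.hasSum_inner_onb (A : TraceClass H) :
    HasSum (fun k => ⟪onb H k, (A : H →L[ℂ] H) (onb H k)⟫_ℂ)
      (trace ((A : H →L[ℂ] H) : H →ₗ[ℂ] H)) := by
  obtain ⟨_, _, _, h⟩ := A.2.exists_nuclear
  exact (h.summable_inner (onb H).orthonormal (onb H).orthonormal).of_norm.hasSum

variable (H) in
/-- The trace as a linear functional on the trace class. -/
def traceFunctional : TraceClass H →ₗ[ℂ] ℂ where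
  toFun A := trace ((A : H →L[ℂ] H) : H →ₗ[ℂ] H)
  map_add' A C := by
    refine (TraceClass.hasSum_inner_onb (A + C)).unique ?_
    simpa [inner_add_right] using (TraceClass.hasSum_inner_onb A).add (TraceClass.hasSum_inner_onb C)
  map_smul' c A := by
    refine (TraceClass.hasSum_inner_onb (c • A)).unique ?_
    simpa [inner_smul_right] using (TraceClass.hasSum_inner_onb A).mul_left c

lemma traceFunctional_nonneg {A : TraceClass H} (hA : (A : H →L[ℂ] H).IsPositive) :
    0 ≤ traceFunctional H A :=
  (TraceClass.hasSum_inner_onb A).nonneg fun _ => hA.inner_nonneg_right _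

/-- The vector functional `A ↦ ⟨u, A u⟩` on the trace class. -/
def vectorFunctional (u : H) : TraceClass H →ₗ[ℂ] ℂ where
  toFun A := ⟪u, (A : H →L[ℂ] H) u⟫_ℂ
  map_add' A C := by simp
  map_smul' c A := by simp

lemma hasSum_norm_inner_onb_sq (z : H) :
    HasSum (fun i => ‖⟪onb H i, z⟫_ℂ‖ ^ 2) (‖z‖ ^ 2) := by
  have h := (onb H).hasSum_inner_mul_inner z z
  rw [inner_self_eq_norm_sq_to_K] at h
  rw [← Complex.hasSum_ofReal]
  have e : ((‖z‖ ^ 2 : ℝ) : ℂ) = (‖z‖ : ℂ) ^ 2 := by simp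
  rw [e]
  refine h.congr_fun fun i => ?_
  rw [← inner_conj_symm z, mul_comm, Complex.mul_conj, Complex.normSq_eq_norm_sq]

lemma HilbertSchmidt.hasSum_norm_sq (X : HilbertSchmidt H) :
    HasSum (fun k => ‖toCLM H X (onb H k)‖ ^ 2) (‖X‖ ^ 2) := by
  have h := HilbertSchmidt.hasSum_inner X X
  rw [inner_self_eq_norm_sq_to_K] at h
  rw [← Complex.hasSum_ofReal]
  convert h using 2 with i
  · rw [inner_self_eq_norm_sq_to_K]; simp
  · simp

/-- Sum the entrywise Cauchy-Schwarz bound over both basis indices: the right side factors into two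
traces. -/
lemma CP.norm_toHilbertSchmidt_sq_le {Φ : TraceClass H →ₗ[ℂ] TraceClass H}
    (hΦ : Φ ∈ CP H) (x y : H) :
    ‖TraceClass.toHilbertSchmidt (Φ (ketBra x y))‖ ^ 2 ≤
      (traceFunctional H (Φ (ketBra x x))).re * (traceFunctional H (Φ (ketBra y y))).re := by
  have hx := Complex.hasSum_re (TraceClass.hasSum_inner_onb (Φ (ketBra x x)))
  have hy := Complex.hasSum_re (TraceClass.hasSum_inner_onb (Φ (ketBra y y)))
  refine hasSum_le (fun k => ?_) (HilbertSchmidt.hasSum_norm_sq _) (hy.mul_left _)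
  exact hasSum_le (fun i => CP.norm_inner_sq_le hΦ x y (onb H i) (onb H k))
    (hasSum_norm_inner_onb_sq _) (hx.mul_right _)

/-! ### The weighted map as a nuclear operator -/

lemma HasNuclearSum.adjoint {ι : Type*} {A : H →L[ℂ] H} {x y : ι → H}
    (h : HasNuclearSum A x y) : HasNuclearSum (ContinuousLinearMap.adjoint A) y x := by
  obtain ⟨C, hC⟩ := exists_hasNuclearSum (x := y) (y := x) (by simpa [mul_comm] using h.1)
  have : ContinuousLinearMap.adjoint A = C := by
    ext z
    refine ext_inner_left ℂ fun u => ?_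
    rw [ContinuousLinearMap.adjoint_inner_right, ← inner_conj_symm]
    refine ((Complex.hasSum_conj'.2 (h.hasSum_inner z u))).unique ?_
    convert hC.hasSum_inner u z using 2 with n
    simp [mul_comm]
  rwa [this]

/-- This expands `B* X B = ∑ sₘ sₙ ⟨fₘ, X fₙ⟩ |gₘ⟩⟨gₙ|`. The weight is split as `√(sₘ sₙ)` on each
side so that both families are square-summable, as `HasNuclearSum.hasSum_of_positive` requires. -/
lemma hasNuclearSum_sandwich {ι : Type*} {B : TraceClass H} {s : ι → ℝ} {f g : ι → H}
    (hs : ∀ j, 0 ≤ s j) (hf : ∀ j, ‖f j‖ = 1) (hg : ∀ j, ‖g j‖ = 1) (hsum : Summable s)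
    (hB : ∀ x, HasSum (fun j => ((s j : ℂ) * ⟪g j, x⟫_ℂ) • f j) ((B : H →L[ℂ] H) x))
    (X : HilbertSchmidt H) :
    HasNuclearSum (sandwich B X : H →L[ℂ] H)
      (fun p : ι × ι => ((√(s p.1) * √(s p.2) : ℝ) : ℂ) •
        ⟪f p.1, HilbertSchmidt.toCLM H X (f p.2)⟫_ℂ • g p.1)
      (fun p : ι × ι => ((√(s p.1) * √(s p.2) : ℝ) : ℂ) • g p.2) ∧
    (Summable fun p : ι × ι => ‖((√(s p.1) * √(s p.2) : ℝ) : ℂ) •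
        ⟪f p.1, HilbertSchmidt.toCLM H X (f p.2)⟫_ℂ • g p.1‖ ^ 2) ∧
    Summable fun p : ι × ι => ‖((√(s p.1) * √(s p.2) : ℝ) : ℂ) • g p.2‖ ^ 2 := by
  set Y := HilbertSchmidt.toCLM H X with hY
  have hss : Summable fun p : ι × ι => s p.1 * s p.2 := hsum.mul_of_nonneg hsum hs hs
  have hsq : ∀ p : ι × ι, ‖((√(s p.1) * √(s p.2) : ℝ) : ℂ)‖ ^ 2 = s p.1 * s p.2 := fun p => by
    rw [Complex.norm_real, Real.norm_eq_abs, sq_abs, mul_pow, Real.sq_sqrt (hs _),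
      Real.sq_sqrt (hs _)]
  have hbd : ∀ m n, ‖⟪f m, Y (f n)⟫_ℂ‖ ≤ ‖Y‖ := fun m n => by
    refine (norm_inner_le_norm _ _).trans ?_
    rw [hf, one_mul]
    simpa [hf] using Y.le_opNorm (f n)
  have ha : Summable fun p : ι × ι => ‖((√(s p.1) * √(s p.2) : ℝ) : ℂ) •
        ⟪f p.1, Y (f p.2)⟫_ℂ • g p.1‖ ^ 2 := by
    refine Summable.of_nonneg_of_le (fun p => by positivity) (fun p => ?_)
      (hss.mul_right (‖Y‖ ^ 2))
    rw [norm_smul, norm_smul, mul_pow, hsq, hg, mul_one]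
    have := mul_nonneg (hs p.1) (hs p.2)
    gcongr
    exact hbd _ _
  have hb : Summable fun p : ι × ι => ‖((√(s p.1) * √(s p.2) : ℝ) : ℂ) • g p.2‖ ^ 2 := by
    refine hss.congr fun p => ?_
    rw [norm_smul, mul_pow, hsq, hg]; simp
  refine ⟨?_, ha, hb⟩
  obtain ⟨C, hC⟩ := exists_hasNuclearSum (summable_norm_mul_norm ha hb)
  have hBn : HasNuclearSum (B : H →L[ℂ] H) (fun j => (s j : ℂ) • f j) g := by
    refine ⟨hsum.congr fun j => ?_, fun z => (hB z).congr_fun fun j => ?_⟩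
    · simp [norm_smul, hf, hg, abs_of_nonneg (hs j)]
    · rw [smul_smul, mul_comm]
  have hCs : (sandwich B X : H →L[ℂ] H) = C := by
    ext z
    change ContinuousLinearMap.adjoint (B : H →L[ℂ] H) (Y ((B : H →L[ℂ] H) z)) = _
    refine (hBn.adjoint.2 _).unique ((hC.2 z).prod_fiberwise fun m => ?_)
    have h1 := ((innerSL ℂ ((s m : ℂ) • f m)).hasSum (Y.hasSum (hB z))).smul_const (g m)
    simp only [innerSL_apply_apply] at h1
    refine h1.congr_fun fun n => ?_
    have e : ((√(s m) * √(s n) : ℝ) : ℂ) * ((√(s m) * √(s n) : ℝ) : ℂ) = s m * s n := by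
      rw [← Complex.ofReal_mul, ← Complex.ofReal_mul]
      congr 1
      calc _ = (√(s m) * √(s m)) * (√(s n) * √(s n)) := by ring
        _ = _ := by rw [Real.mul_self_sqrt (hs _), Real.mul_self_sqrt (hs _)]
    simp only [smul_smul, map_smul, inner_smul_left, inner_smul_right, Complex.conj_ofReal]
    congr 1
    linear_combination (⟪g n, z⟫_ℂ * ⟪f m, Y (f n)⟫_ℂ) * e
  rwa [hCs]

/-- On `𝓑²(H)` the weighted map is the nuclear sum of `|xₚ⟩⟨yₚ|` with `xₚ = sₘ sₙ Φ(|gₘ⟩⟨gₙ|)` and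
`yₚ = |fₘ⟩⟨fₙ|`, so its trace is `∑ ⟨yₚ, xₚ⟩`. Nuclearity follows from `‖xₚ‖ ≤ (sₘ √τₘ) (sₙ √τₙ)`.
-/
lemma CP.hasSum_trace_weighted {Φ : TraceClass H →ₗ[ℂ] TraceClass H} (hΦ : Φ ∈ CP H)
    {ι : Type*} {B : TraceClass H} {s : ι → ℝ} {f g : ι → H}
    (hs : ∀ j, 0 ≤ s j) (hf : ∀ j, ‖f j‖ = 1) (hg : ∀ j, ‖g j‖ = 1) (hsum : Summable s)
    (hB : ∀ x, HasSum (fun j => ((s j : ℂ) * ⟪g j, x⟫_ℂ) • f j) ((B : H →L[ℂ] H) x)) :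
    HasSum (fun p : ι × ι => (s p.1 * s p.2 : ℂ) *
      ⟪f p.1, (Φ (ketBra (g p.1) (g p.2)) : H →L[ℂ] H) (f p.2)⟫_ℂ) (trace (weighted Φ B)) := by
  set τ : ι → ℝ := fun m => (traceFunctional H (Φ (ketBra (g m) (g m)))).re with hτ
  have hτ0 : ∀ m, 0 ≤ τ m := fun m => (Complex.le_def.1 (traceFunctional_nonneg
    (CP.isPositive hΦ (InnerProductSpace.isPositive_rankOne_self (g m))))).1
  -- Countable additivity of `tr ∘ Φ` on the trace-class operator `∑ sₘ |gₘ⟩⟨gₘ|`.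
  have hsτ : Summable fun m => s m * τ m := by
    have h1 : Summable fun m => ‖((√(s m) : ℝ) : ℂ) • g m‖ * ‖((√(s m) : ℝ) : ℂ) • g m‖ := by
      refine hsum.congr fun m => ?_
      simp [norm_smul, hg, abs_of_nonneg (Real.sqrt_nonneg _), Real.mul_self_sqrt (hs m)]
    obtain ⟨P, hP⟩ := exists_hasNuclearSum h1
    have h2 := (hasSum_re_of_positive (φ := traceFunctional H ∘ₗ Φ)
      (fun A hA => traceFunctional_nonneg (CP.isPositive hΦ hA)) hP).summable
    refine h2.congr fun m => ?_
    rw [ketBra_smul_left, ketBra_smul_right, smul_smul]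
    have : ((√(s m) : ℝ) : ℂ) * star ((√(s m) : ℝ) : ℂ) = (s m : ℂ) := by
      rw [Complex.star_def, Complex.conj_ofReal, ← Complex.ofReal_mul, Real.mul_self_sqrt (hs m)]
    rw [this]
    simp [hτ]
  have hsτ' : Summable fun m => s m * √(τ m) := by
    refine Summable.of_nonneg_of_le (fun m => mul_nonneg (hs m) (Real.sqrt_nonneg _))
      (fun m => ?_) (hsum.add hsτ)
    have h1 : √(τ m) ≤ 1 + τ m := by
      nlinarith [Real.sq_sqrt (hτ0 m), sq_nonneg (√(τ m) - 1), Real.sqrt_nonneg (τ m)]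
    nlinarith [hs m]
  let x : ι × ι → HilbertSchmidt H := fun p => (s p.1 * s p.2 : ℂ) •
    TraceClass.toHilbertSchmidt (Φ (ketBra (g p.1) (g p.2)))
  let y : ι × ι → HilbertSchmidt H := fun p => TraceClass.toHilbertSchmidt (ketBra (f p.1) (f p.2))
  have hxn : ∀ p, ‖x p‖ ≤ (s p.1 * √(τ p.1)) * (s p.2 * √(τ p.2)) := fun p => by
    have h1 : ‖TraceClass.toHilbertSchmidt (Φ (ketBra (g p.1) (g p.2)))‖ ≤ √(τ p.1) * √(τ p.2) := by
      rw [← Real.sqrt_mul (hτ0 _)]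
      exact Real.le_sqrt_of_sq_le (CP.norm_toHilbertSchmidt_sq_le hΦ _ _)
    have h2 : ‖(s p.1 * s p.2 : ℂ)‖ = s p.1 * s p.2 := by
      simp [abs_of_nonneg (hs _)]
    have h3 := mul_nonneg (hs p.1) (hs p.2)
    calc ‖x p‖ = s p.1 * s p.2 * ‖TraceClass.toHilbertSchmidt (Φ (ketBra (g p.1) (g p.2)))‖ := by
          rw [← h2]; exact norm_smul _ _
      _ ≤ s p.1 * s p.2 * (√(τ p.1) * √(τ p.2)) := by gcongr
      _ = _ := by ring
  have hxy : Summable fun p => ‖x p‖ * ‖y p‖ := by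
    refine Summable.of_nonneg_of_le (fun p => by positivity) (fun p => ?_)
      (hsτ'.mul_of_nonneg hsτ' (fun m => mul_nonneg (hs m) (Real.sqrt_nonneg _))
        (fun m => mul_nonneg (hs m) (Real.sqrt_nonneg _)))
    simpa [y, HilbertSchmidt.norm_ketBra, hf] using hxn p
  have hT : ∀ X, HasSum (fun p => ⟪y p, X⟫_ℂ • x p) (weighted Φ B X) := fun X => by
    have hsm : Summable fun p => ⟪y p, X⟫_ℂ • x p := by
      refine Summable.of_norm (Summable.of_nonneg_of_le (fun _ => norm_nonneg _) (fun p => ?_)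
        (hxy.mul_left ‖X‖))
      rw [norm_smul]
      calc ‖⟪y p, X⟫_ℂ‖ * ‖x p‖ ≤ (‖y p‖ * ‖X‖) * ‖x p‖ := by
            gcongr; exact norm_inner_le_norm _ _
        _ = _ := by ring
    obtain ⟨W, hW⟩ := hsm
    suffices W = weighted Φ B X by rwa [← this]
    apply HilbertSchmidt.toCLM_injective
    -- Only quadratic forms are compared, because `A ↦ ⟨u, Φ(A) u⟩` is a positive functional and so
    -- passes through the infinite sum for `B* X B`. Over `ℂ` they determine the operator.
    have hdiag : ∀ u : H, ⟪u, HilbertSchmidt.toCLM H W u⟫_ℂ =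
        ⟪u, HilbertSchmidt.toCLM H (weighted Φ B X) u⟫_ℂ := fun u => by
      have h1 := (innerSL ℂ (TraceClass.toHilbertSchmidt (ketBra u u))).hasSum hW
      simp only [innerSL_apply_apply, HilbertSchmidt.inner_ketBra] at h1
      obtain ⟨h2, h3, h4⟩ := hasNuclearSum_sandwich hs hf hg hsum hB X
      have h5 := h2.hasSum_of_positive (φ := vectorFunctional u ∘ₗ Φ)
        (fun A hA => (CP.isPositive hΦ hA).inner_nonneg_right u) h3 h4
      refine h1.unique (HasSum.congr_fun h5 fun p => ?_)
      simp only [y, HilbertSchmidt.inner_ketBra, ketBra_smul_left, ketBra_smul_right, map_smul,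
        smul_eq_mul, x, smul_apply, inner_smul_right]
      have e : ((√(s p.1) * √(s p.2) : ℝ) : ℂ) * star ((√(s p.1) * √(s p.2) : ℝ) : ℂ)
          = s p.1 * s p.2 := by
        rw [Complex.star_def, Complex.conj_ofReal, ← Complex.ofReal_mul, ← Complex.ofReal_mul]
        congr 1
        calc _ = (√(s p.1) * √(s p.1)) * (√(s p.2) * √(s p.2)) := by ring
          _ = _ := by rw [Real.mul_self_sqrt (hs _), Real.mul_self_sqrt (hs _)]
      change _ * ((s p.1 * s p.2 : ℂ) * ⟪u, (Φ (ketBra (g p.1) (g p.2)) : H →L[ℂ] H) u⟫_ℂ) =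
        _ * (_ * (_ * ⟪u, (Φ (ketBra (g p.1) (g p.2)) : H →L[ℂ] H) u⟫_ℂ))
      linear_combination (-⟪f p.1, HilbertSchmidt.toCLM H X (f p.2)⟫_ℂ *
        ⟪u, (Φ (ketBra (g p.1) (g p.2)) : H →L[ℂ] H) u⟫_ℂ) * e
    have := (ext_inner_map (HilbertSchmidt.toCLM H W : H →ₗ[ℂ] H)
      (HilbertSchmidt.toCLM H (weighted Φ B X) : H →ₗ[ℂ] H)).1 fun u => by
        simpa using congrArg (starRingEnd ℂ) (hdiag u)
    exact ContinuousLinearMap.coe_injective this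
  refine (hasSum_trace hxy hT).congr_fun fun p => ?_
  simp only [x, y, inner_smul_right, HilbertSchmidt.inner_ketBra]
  rfl

/-- If the trace of `Φ(B* (·) B)` vanishes, then `B` is null for the positive form of `Φ`, hence
orthogonal to all rank-one operators. -/
lemma CPWeighted.hasSum_inner_zero {B : TraceClass H} {Φ : TraceClass H →ₗ[ℂ] TraceClass H}
    (hΦ : Φ ∈ CPWeighted B) {ι : Type*} {s : ι → ℝ} {f g : ι → H}
    (hs : ∀ j, 0 ≤ s j) (hf : ∀ j, ‖f j‖ = 1) (hg : ∀ j, ‖g j‖ = 1) (hsum : Summable s)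
    (hB : ∀ x, HasSum (fun j => ((s j : ℂ) * ⟪g j, x⟫_ℂ) • f j) ((B : H →L[ℂ] H) x)) (w v : H) :
    HasSum (fun j => (s j : ℂ) * ⟪f j, (Φ (ketBra (g j) w) : H →L[ℂ] H) v⟫_ℂ) 0 := by
  have h := CP.hasSum_trace_weighted hΦ.1 hs hf hg hsum hB
  rw [hΦ.2] at h
  -- Restricted to squares `F × F`, the partial sums of the trace are the positive form at finite
  -- truncations of `B`; they tend to `0`, and Cauchy-Schwarz applies to each.
  have hdiag : Tendsto (fun F : Finset ι => F ×ˢ F) atTop atTop := by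
    have h1 : Tendsto (fun F : Finset ι => (F, F)) atTop atTop := by
      rw [← prod_atTop_atTop_eq]
      exact tendsto_id.prodMk tendsto_id
    exact tendsto_finsetProd_atTop.comp h1
  set d := (⟪v, (Φ (ketBra w w) : H →L[ℂ] H) v⟫_ℂ).re
  have hq := ((Complex.continuous_re.tendsto _).comp (Tendsto.comp h hdiag)).mul_const d
  rw [Complex.zero_re, zero_mul] at hq
  have hle : ∀ F : Finset ι,
      ‖∑ j ∈ F, (s j : ℂ) * ⟪f j, (Φ (ketBra (g j) w) : H →L[ℂ] H) v⟫_ℂ‖ ^ 2 ≤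
      (∑ p ∈ F ×ˢ F, (s p.1 * s p.2 : ℂ) *
        ⟪f p.1, (Φ (ketBra (g p.1) (g p.2)) : H →L[ℂ] H) (f p.2)⟫_ℂ).re * d := fun F => by
    have h2 := CP.norm_sum_inner_sq_le hΦ.1 (fun j : F => g j) (fun j : F => (s j : ℂ) • f j) w v
    simp only [inner_smul_left, inner_smul_right, map_smul, Complex.conj_ofReal] at h2
    rw [Finset.sum_coe_sort F fun j => (s j : ℂ) * ⟪f j, (Φ (ketBra (g j) w) : H →L[ℂ] H) v⟫_ℂ,
      Finset.sum_coe_sort F fun i => ∑ j : F, (s j : ℂ) *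
        ((s i : ℂ) * ⟪f i, (Φ (ketBra (g i) (g j)) : H →L[ℂ] H) (f j)⟫_ℂ)] at h2
    refine h2.trans (le_of_eq ?_)
    rw [Finset.sum_product]
    congr 2
    refine Finset.sum_congr rfl fun i _ => ?_
    rw [Finset.sum_coe_sort F fun j => (s j : ℂ) *
        ((s i : ℂ) * ⟪f i, (Φ (ketBra (g i) (g j)) : H →L[ℂ] H) (f j)⟫_ℂ)]
    exact Finset.sum_congr rfl fun j _ => by ring
  have h3 : Tendsto (fun F : Finset ι =>
      ‖∑ j ∈ F, (s j : ℂ) * ⟪f j, (Φ (ketBra (g j) w) : H →L[ℂ] H) v⟫_ℂ‖ ^ 2) atTop (𝓝 0) :=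
    squeeze_zero (fun _ => by positivity) hle hq
  have h4 := h3.sqrt
  simp only [Real.sqrt_sq (norm_nonneg _), Real.sqrt_zero] at h4
  exact tendsto_zero_iff_norm_tendsto_zero.2 h4

end QDyn

end

/-! ### The scalar equation for `K` -/

open scoped InnerProductSpace in
theorem proposition2 {H : Type*} [NormedAddCommGroup H] [InnerProductSpace ℂ H] [CompleteSpace H]
    [TopologicalSpace.SeparableSpace H] (K : H →L[ℂ] H) (B : QDyn.TraceClass H)
    (hB : QDyn.trace ((B : H →L[ℂ] H) : H →ₗ[ℂ] H) ≠ 0)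
    (hK : ∃ Φ₁ ∈ QDyn.CPWeighted B, ∃ Φ₂ ∈ QDyn.CPWeighted B, QDyn.leftRight K = Φ₁ - Φ₂) :
    ∃ l : ℝ, K = (Complex.I * (l : ℂ)) • ContinuousLinearMap.id ℂ H := by
  obtain ⟨Φ₁, h₁, Φ₂, h₂, hK⟩ := hK
  obtain ⟨N, s, f, g, hs, hf, hg, hsum, hBs⟩ := B.2
  have hs0 : ∀ j, 0 ≤ s j := fun j => (hs j).le
  -- `α = tr(B* K)` and `β = tr(B*)`
  have hsm : ∀ L : H →L[ℂ] H, Summable fun j => (s j : ℂ) * ⟪f j, L (g j)⟫_ℂ := fun L => by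
    refine Summable.of_norm (Summable.of_nonneg_of_le (fun _ => norm_nonneg _) (fun j => ?_)
      (hsum.mul_right ‖L‖))
    rw [norm_mul, Complex.norm_real, Real.norm_eq_abs, abs_of_nonneg (hs0 j)]
    refine mul_le_mul_of_nonneg_left ((norm_inner_le_norm _ _).trans ?_) (hs0 j)
    simpa [hf.1, hg.1] using L.le_opNorm (g j)
  obtain ⟨α, hα⟩ := hsm K
  obtain ⟨β, hβ⟩ := hsm (ContinuousLinearMap.id ℂ H)
  simp only [ContinuousLinearMap.id_apply] at hβ
  -- `β` is the complex conjugate of `tr B`.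
  have hβ0 : β ≠ 0 := by
    have ht := QDyn.hasSum_trace (T := ((B : H →L[ℂ] H) : H →ₗ[ℂ] H))
      (x := fun j => (s j : ℂ) • f j) (y := g)
      (hsum.congr fun j => by simp [norm_smul, hf.1, hg.1, abs_of_pos (hs j)])
      (fun z => (hBs z).congr_fun fun j => by rw [smul_smul, mul_comm])
    intro h0
    apply hB
    have := Complex.hasSum_conj'.2 ht
    rw [← star_eq_zero]
    refine this.unique ?_
    rw [h0] at hβ
    exact hβ.congr_fun fun j => by simp
  -- The two null identities are subtracted, and `Φ₁ - Φ₂` is evaluated on `|gⱼ⟩⟨w|` as `|K gⱼ⟩⟨w| +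
  -- |gⱼ⟩⟨K w|`.
  have key : ∀ w v : H, α * ⟪w, v⟫_ℂ + β * ⟪K w, v⟫_ℂ = 0 := fun w v => by
    have h := (QDyn.CPWeighted.hasSum_inner_zero h₁ hs0 hf.1 hg.1 hsum hBs w v).sub
      (QDyn.CPWeighted.hasSum_inner_zero h₂ hs0 hf.1 hg.1 hsum hBs w v)
    rw [sub_zero] at h
    refine ((hα.mul_right ⟪w, v⟫_ℂ).add (hβ.mul_right ⟪K w, v⟫_ℂ)).unique
      (h.congr_fun fun j => ?_)
    have hj : (Φ₁ (QDyn.ketBra (g j) w) : H →L[ℂ] H) v - (Φ₂ (QDyn.ketBra (g j) w) : H →L[ℂ] H) v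
        = ⟪w, v⟫_ℂ • K (g j) + ⟪K w, v⟫_ℂ • g j := by
      have := congrArg (fun Ψ => (Ψ (QDyn.ketBra (g j) w) : H →L[ℂ] H) v) hK
      simpa [QDyn.leftRight, ContinuousLinearMap.adjoint_inner_right] using this.symm
    rw [← mul_sub, ← inner_sub_right, hj, inner_add_right, inner_smul_right, inner_smul_right]
    ring
  -- The conjugate appears because the inner product is conjugate-linear in its first slot, where `K
  -- w` stands.
  set c : ℂ := -star (α / β) with hc
  have hKc : ∀ w, K w = c • w := fun w => by
    refine ext_inner_right ℂ fun v => ?_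
    have := key w v
    rw [inner_smul_left, hc]
    simp only [map_neg, Complex.star_def, Complex.conj_conj]
    field_simp
    linear_combination this
  -- Putting `K = c` back into the series for `α` gives `α / β = c`, hence `c = -c̄`.
  have hαc : α = c * β := hα.unique ((hβ.mul_left c).congr_fun fun j => by
    rw [hKc, inner_smul_right]; ring)
  have hre : c.re = 0 := by
    have h1 : star c = -(α / β) := by simp [hc]
    rw [hαc, mul_div_cancel_right₀ _ hβ0] at h1
    have := congrArg Complex.re h1
    simp at this
    linarith
  refine ⟨c.im, ?_⟩
  ext w
  rw [hKc]
  have : c = Complex.I * (c.im : ℂ) := Complex.ext (by simp [hre]) (by simp)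
  rw [← this]
  simp
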